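/- Let $\mathcal{A}=(\mathcal{A},\mathbb{E},\mathfrak{s})$ be a Krull–Schmidt extriangulated category (in the sense of Nakaoka–Palu). A length function on $\mathcal{A}$ is an isomorphism-invariant map $\Theta$ from the objects of $\mathcal{A}$ to $\mathbb{N}$ such that $\Theta(X)=0$ if and only if $X\cong 0$, and $\Theta(L)\le\Theta(X)+\Theta(M)$ for every $\mathbb{E}$-triangle $X\to L\to M\overset{\delta}{\dashrightarrow}$, with equality if $\delta=0$. An $\mathbb{E}$-triangle $X\xrightarrow{x}L\xrightarrow{y}M\dashrightarrow$ is stable if $\Theta(L)=\Theta(X)+\Theta(M)$; then $x$ is called a $\Theta$-inflation and $y$ a $\Theta$-deflation. Assume that $(\mathcal{A},\Theta)$ is a length category, i.e. $\Theta$ is a length function and every morphism of $\mathcal{A}$ is a composite $j\circ i$ of a $\Theta$-deflation $i$ and a $\Theta$-inflation $j$. All subcategories are full and closed under isomorphisms. For a subcategory (or object) $\mathcal{S}$, let $\mathrm{Fac}_\Theta(\mathcal{S})$ (resp. $\mathrm{Sub}_\Theta(\mathcal{S})$) be the class of objects $M$ admitting a $\Theta$-deflation $S\to M$ (resp. a $\Theta$-inflation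 $M\to S$) with $S\in\mathcal{S}$; let $\mathcal{S}^{\perp}=\{M\mid \mathrm{Hom}(\mathcal{S},M)=0\}$ and ${}^{\perp}\mathcal{S}=\{M\mid\mathrm{Hom}(M,\mathcal{S})=0\}$. A torsion class is a non-empty subcategory $\mathcal{T}$ with $\mathrm{Fac}_\Theta(\mathcal{T})\subseteq\mathcal{T}$ such that the middle term of every stable $\mathbb{E}$-triangle with both end terms in $\mathcal{T}$ lies in $\mathcal{T}$. Let $\mathrm{tors}_\Theta(\mathcal{A})$ be the set of torsion classes ordered by inclusion, and let $\mathrm{T}_\Theta(\mathcal{S})$ be the intersection of all torsion classes containing $\mathcal{S}$. A brick is an object whose endomorphism ring is a division ring. Let $\mathcal{U}\subseteq\mathcal{T}$ be torsion classes, let $[\mathcal{U},\mathcal{T}]=\{\mathcal{V}\in\mathrm{tors}_\Theta(\mathcal{A})\mid\mathcal{U}\subseteq\mathcal{V}\subseteq\mathcal{T}\}$, and let $\mathrm{brick}(\mathcal{U}^{\perp}\cap\mathcal{T})$ be the set of isomorphism classes of bricks lying in $\mathcal{U}^{\perp}\cap\mathcal{T}$. (1) $\#[\mathcal{U},\mathcal{T}]=1$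 if and only if $\mathrm{brick}(\mathcal{U}^{\perp}\cap\mathcal{T})=\emptyset$. (2) If $\#\,\mathrm{brick}(\mathcal{U}^{\perp}\cap\mathcal{T})=1$, then $\#[\mathcal{U},\mathcal{T}]=2$. (3) If $\#[\mathcal{U},\mathcal{T}]=2$, then there is a brick $S\in\mathrm{brick}(\mathcal{U}^{\perp}\cap\mathcal{T})$ such that (i) $\Theta(S)\le\Theta(S')$ for every $S'\in\mathrm{brick}(\mathcal{U}^{\perp}\cap\mathcal{T})$; (ii) $\mathcal{T}=\mathrm{T}_\Theta(\mathcal{U}\cup\{S\})$ and $\mathcal{U}=\mathcal{T}\cap{}^{\perp}S$; (iii) $S\in\mathrm{Sub}_\Theta(S')\cap\mathrm{Fac}_\Theta(S')$ for every $S'\in\mathrm{brick}(\mathcal{U}^{\perp}\cap\mathcal{T})$. Moreover, $S$ is unique up to isomorphism; in fact it is, up to isomorphism, the only brick in $\mathcal{U}^{\perp}\cap\mathcal{T}$ satisfying (i). -/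

import Mathlib

open CategoryTheory CategoryTheory.Limits Opposite

universe w v u

namespace ExtriLength

section Extriangulated

variable {C : Type u} [Category.{v} C]

/-- A sequence `X ⟶ mid ⟶ Z` with fixed end terms `X` and `Z`. -/
structure ThreeTerm (X Z : C) where
  mid : C
  i : X ⟶ mid
  p : mid ⟶ Z

/-- Two sequences with the same end terms are equivalent if there is an isomorphism of
the middle terms which is compatible with the identities of the end terms. -/
def ThreeTerm.setoid (X Z : C) : Setoid (ThreeTerm X Z) where
  r s t := ∃ e : s.mid ≅ t.mid, s.i ≫ e.hom = t.i ∧ e.hom ≫ t.p = s.p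
  iseqv :=
    { refl := fun _ => ⟨Iso.refl _, by simp, by simp⟩
      symm := by
        rintro s t ⟨e, h₁, h₂⟩
        exact ⟨e.symm, by simp [← h₁], by simp [← h₂]⟩
      trans := by
        rintro s t r ⟨e, h₁, h₂⟩ ⟨e', h₁', h₂'⟩
        exact ⟨e ≪≫ e', by simp [← h₁', ← h₁], by simp [h₂, h₂']⟩ }

variable (C) in
/-- The data `(𝔼, 𝔰)` of an extriangulated category: a bifunctor `Cᵒᵖ × C ⥤ Ab`, and a
correspondence `𝔰` which sends `δ ∈ 𝔼(Z, X)` to an equivalence class of sequences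
`X ⟶ Y ⟶ Z`. The axioms are in `ExtriData.IsExtriangulated`. -/
structure ExtriData where
  E : Cᵒᵖ ⥤ C ⥤ AddCommGrpCat.{w}
  s : ∀ {Z X : C}, (E.obj (op Z)).obj X → Quotient (ThreeTerm.setoid X Z)

namespace ExtriData

variable (𝔼 : ExtriData.{w} C)

/-- The group `𝔼(Z, X)` of extensions. -/
abbrev Ext (Z X : C) : Type w := (𝔼.E.obj (op Z)).obj X

/-- The map `a_* : 𝔼(Z, X) → 𝔼(Z, X')`. -/
def push {Z X X' : C} (a : X ⟶ X') : 𝔼.Ext Z X →+ 𝔼.Ext Z X' :=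
  ((𝔼.E.obj (op Z)).map a).hom

/-- The map `c^* : 𝔼(Z, X) → 𝔼(Z', X)`. -/
def pull {Z Z' X : C} (c : Z' ⟶ Z) : 𝔼.Ext Z X →+ 𝔼.Ext Z' X :=
  ((𝔼.E.map c.op).app X).hom

/-- `X -x-> Y -y-> Z` together with `δ` is an `𝔼`-triangle: `𝔰(δ) = [X -x-> Y -y-> Z]`. -/
def IsTriangle {X Y Z : C} (x : X ⟶ Y) (y : Y ⟶ Z) (δ : 𝔼.Ext Z X) : Prop :=
  𝔼.s δ = Quotient.mk (ThreeTerm.setoid X Z) ⟨Y, x, y⟩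

variable [Preadditive C] [HasBinaryBiproducts C]

/-- The direct sum `δ ⊕ δ' ∈ 𝔼(Z ⊕ Z', X ⊕ X')` of two extensions. -/
noncomputable def directSum {X X' Z Z' : C} (δ : 𝔼.Ext Z X) (δ' : 𝔼.Ext Z' X') :
    𝔼.Ext (Z ⊞ Z') (X ⊞ X') :=
  𝔼.push biprod.inl (𝔼.pull biprod.fst δ) + 𝔼.push biprod.inr (𝔼.pull biprod.snd δ')

/-- The axioms of an extriangulated category (Nakaoka and Palu). -/
structure IsExtriangulated : Prop where
  /-- (ET1) -/
  additive_left : 𝔼.E.Additive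
  additive_right : ∀ Z : Cᵒᵖ, (𝔼.E.obj Z).Additive
  /-- (ET2), `𝔰` is a realization: morphisms of extensions lift to the middle terms. -/
  realize : ∀ {X Y Z X' Y' Z' : C} {x : X ⟶ Y} {y : Y ⟶ Z} {δ : 𝔼.Ext Z X}
    {x' : X' ⟶ Y'} {y' : Y' ⟶ Z'} {δ' : 𝔼.Ext Z' X'},
    𝔼.IsTriangle x y δ → 𝔼.IsTriangle x' y' δ' →
    ∀ (a : X ⟶ X') (c : Z ⟶ Z'), 𝔼.push a δ = 𝔼.pull c δ' →
      ∃ b : Y ⟶ Y', x ≫ b = a ≫ x' ∧ y ≫ c = b ≫ y'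
  /-- (ET2), the realization is additive. -/
  realize_zero : ∀ X Z : C,
    𝔼.IsTriangle (biprod.inl : X ⟶ X ⊞ Z) (biprod.snd : X ⊞ Z ⟶ Z) 0
  realize_sum : ∀ {X Y Z X' Y' Z' : C} {x : X ⟶ Y} {y : Y ⟶ Z} {δ : 𝔼.Ext Z X}
    {x' : X' ⟶ Y'} {y' : Y' ⟶ Z'} {δ' : 𝔼.Ext Z' X'},
    𝔼.IsTriangle x y δ → 𝔼.IsTriangle x' y' δ' →
    𝔼.IsTriangle (biprod.map x x') (biprod.map y y') (𝔼.directSum δ δ')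
  /-- (ET3) -/
  et3 : ∀ {X Y Z X' Y' Z' : C} {x : X ⟶ Y} {y : Y ⟶ Z} {δ : 𝔼.Ext Z X}
    {x' : X' ⟶ Y'} {y' : Y' ⟶ Z'} {δ' : 𝔼.Ext Z' X'},
    𝔼.IsTriangle x y δ → 𝔼.IsTriangle x' y' δ' →
    ∀ (a : X ⟶ X') (b : Y ⟶ Y'), x ≫ b = a ≫ x' →
      ∃ c : Z ⟶ Z', y ≫ c = b ≫ y' ∧ 𝔼.push a δ = 𝔼.pull c δ'
  /-- (ET3)ᵒᵖ -/
  et3_op : ∀ {X Y Z X' Y' Z' : C} {x : X ⟶ Y} {y : Y ⟶ Z} {δ : 𝔼.Ext Z X}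
    {x' : X' ⟶ Y'} {y' : Y' ⟶ Z'} {δ' : 𝔼.Ext Z' X'},
    𝔼.IsTriangle x y δ → 𝔼.IsTriangle x' y' δ' →
    ∀ (b : Y ⟶ Y') (c : Z ⟶ Z'), y ≫ c = b ≫ y' →
      ∃ a : X ⟶ X', x ≫ b = a ≫ x' ∧ 𝔼.push a δ = 𝔼.pull c δ'
  /-- (ET4): for `𝔼`-triangles `A -f-> B -f'-> D` and `B -g-> B' -g'-> F`, with
  `h = f ≫ g : A ⟶ B'`. -/
  et4 : ∀ {A B D B' F : C} {f : A ⟶ B} {f' : B ⟶ D} {δ : 𝔼.Ext D A}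
    {g : B ⟶ B'} {g' : B' ⟶ F} {δ' : 𝔼.Ext F B},
    𝔼.IsTriangle f f' δ → 𝔼.IsTriangle g g' δ' →
    ∃ (G : C) (h' : B' ⟶ G) (d : D ⟶ G) (e : G ⟶ F) (δ'' : 𝔼.Ext G A),
      𝔼.IsTriangle (f ≫ g) h' δ'' ∧ f' ≫ d = g ≫ h' ∧ h' ≫ e = g' ∧
      𝔼.IsTriangle d e (𝔼.push f' δ') ∧ 𝔼.pull d δ'' = δ ∧
      𝔼.push f δ'' = 𝔼.pull e δ'
  /-- (ET4)ᵒᵖ: for `𝔼`-triangles `D -f'-> A -f-> B` and `F -g'-> B -g-> B'`, with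
  `h = f ≫ g : A ⟶ B'`. -/
  et4_op : ∀ {D A B F B' : C} {f' : D ⟶ A} {f : A ⟶ B} {δ : 𝔼.Ext B D}
    {g' : F ⟶ B} {g : B ⟶ B'} {δ' : 𝔼.Ext B' F},
    𝔼.IsTriangle f' f δ → 𝔼.IsTriangle g' g δ' →
    ∃ (G : C) (h' : G ⟶ A) (d : D ⟶ G) (e : G ⟶ F) (δ'' : 𝔼.Ext B' G),
      𝔼.IsTriangle h' (f ≫ g) δ'' ∧ h' ≫ f = e ≫ g' ∧ d ≫ h' = f' ∧
      𝔼.IsTriangle d e (𝔼.pull g' δ) ∧ 𝔼.push e δ'' = δ' ∧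
      𝔼.push d δ = 𝔼.pull g δ''

end ExtriData

end Extriangulated

section KrullSchmidt

/-- Every object is a finite direct sum of objects with local endomorphism rings. -/
def IsKrullSchmidt (C : Type u) [Category.{v} C] [Preadditive C] [HasFiniteBiproducts C] :
    Prop :=
  ∀ X : C, ∃ (n : ℕ) (F : Fin n → C),
    (∀ i, IsLocalRing (End (F i))) ∧ Nonempty (X ≅ ⨁ F)

/-- A brick: an object whose endomorphism ring is a division ring. -/
def IsBrick {C : Type u} [Category.{v} C] [Preadditive C] (X : C) : Prop :=
  Nontrivial (End X) ∧ ∀ f : End X, f ≠ 0 → IsUnit f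

/-- The set of isomorphism classes of bricks in a subcategory. -/
def brick {C : Type u} [Category.{v} C] [Preadditive C] (P : ObjectProperty C) :
    Set (Quotient (isIsomorphicSetoid C)) :=
  {q | ∃ X : C, IsBrick X ∧ P X ∧ q = Quotient.mk (isIsomorphicSetoid C) X}

end KrullSchmidt

namespace ExtriData

variable {C : Type u} [Category.{v} C] (𝔼 : ExtriData.{w} C) (Θ : C → ℕ)

/-- A length function: a map from isomorphism classes of objects to `ℕ` which vanishes
exactly on zero objects, is subadditive on `𝔼`-triangles and additive on split ones. -/
structure IsLengthFunction : Prop where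
  iso_inv : ∀ {X Y : C}, (X ≅ Y) → Θ X = Θ Y
  eq_zero_iff : ∀ X : C, Θ X = 0 ↔ IsZero X
  le_add : ∀ {X Y Z : C} {x : X ⟶ Y} {y : Y ⟶ Z} {δ : 𝔼.Ext Z X},
    𝔼.IsTriangle x y δ → Θ Y ≤ Θ X + Θ Z
  eq_add_of_split : ∀ {X Y Z : C} {x : X ⟶ Y} {y : Y ⟶ Z},
    𝔼.IsTriangle x y 0 → Θ Y = Θ X + Θ Z

/-- A `Θ`-stable `𝔼`-triangle. -/
def IsStableTriangle {X Y Z : C} (x : X ⟶ Y) (y : Y ⟶ Z) (δ : 𝔼.Ext Z X) : Prop :=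
  𝔼.IsTriangle x y δ ∧ Θ Y = Θ X + Θ Z

/-- A `Θ`-inflation. -/
def IsInflation {X Y : C} (x : X ⟶ Y) : Prop :=
  ∃ (Z : C) (y : Y ⟶ Z) (δ : 𝔼.Ext Z X), 𝔼.IsStableTriangle Θ x y δ

/-- A `Θ`-deflation. -/
def IsDeflation {Y Z : C} (y : Y ⟶ Z) : Prop :=
  ∃ (X : C) (x : X ⟶ Y) (δ : 𝔼.Ext Z X), 𝔼.IsStableTriangle Θ x y δ

/-- A `Θ`-admissible morphism: a `Θ`-deflation followed by a `Θ`-inflation. -/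
def IsAdmissible {M N : C} (f : M ⟶ N) : Prop :=
  ∃ (X : C) (i : M ⟶ X) (j : X ⟶ N),
    𝔼.IsDeflation Θ i ∧ 𝔼.IsInflation Θ j ∧ i ≫ j = f

/-- An extriangulated length category: `Θ` is a length function and every morphism is
`Θ`-admissible. -/
structure IsLengthCategory [Preadditive C] [HasBinaryBiproducts C] : Prop where
  extriangulated : 𝔼.IsExtriangulated
  lengthFunction : 𝔼.IsLengthFunction Θ
  admissible : ∀ {M N : C} (f : M ⟶ N), 𝔼.IsAdmissible Θ f

/-- `Fac_Θ(P)`: targets of `Θ`-deflations from objects of `P`. -/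
def Fac (P : ObjectProperty C) : ObjectProperty C :=
  fun M => ∃ (S : C) (y : S ⟶ M), P S ∧ 𝔼.IsDeflation Θ y

/-- `Sub_Θ(P)`: sources of `Θ`-inflations to objects of `P`. -/
def Sub (P : ObjectProperty C) : ObjectProperty C :=
  fun M => ∃ (S : C) (x : M ⟶ S), P S ∧ 𝔼.IsInflation Θ x

/-- `P *_Θ Q`: middle terms of stable `𝔼`-triangles with end terms in `P` and `Q`. -/
def star (P Q : ObjectProperty C) : ObjectProperty C :=
  fun M => ∃ (T F : C) (x : T ⟶ M) (y : M ⟶ F) (δ : 𝔼.Ext F T),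
    P T ∧ Q F ∧ 𝔼.IsStableTriangle Θ x y δ

/-- A torsion class: a (non-empty, isomorphism-closed, full) subcategory which is closed
under `Θ`-quotients and `Θ`-stable extensions. -/
structure IsTorsionClass (T : ObjectProperty C) : Prop where
  nonempty : ∃ X, T X
  isoClosed : T.IsClosedUnderIsomorphisms
  fac_le : 𝔼.Fac Θ T ≤ T
  star_le : 𝔼.star Θ T T ≤ T

/-- The poset of torsion classes, ordered by inclusion. -/
abbrev Tors : Type u :=
  {T : ObjectProperty C // 𝔼.IsTorsionClass Θ T}

/-- `T_Θ(P)`: the intersection of all torsion classes which contain `P`. -/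
def torsionClosure (P : ObjectProperty C) : ObjectProperty C :=
  fun M => ∀ T : ObjectProperty C, 𝔼.IsTorsionClass Θ T → P ≤ T → T M

end ExtriData

end ExtriLength

namespace ExtriLength

namespace ExtriData

variable {C : Type u} [Category.{v} C] {𝔼 : ExtriData.{w} C} {Θ : C → ℕ}

/-! ### `𝔼`-triangles -/

/-! Everything rests on nonzero objects `S` of minimal length in `Uᗮ ⊓ T`. The image of a nonzero
map `X ⟶ S` with `X` in `T` is a quotient of `X` and a subobject of `S`, hence lies in `Uᗮ ⊓ T`, and
minimality makes it all of `S`. So such maps are deflations (`isDeflation_of_isShortest`) and `S` is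
a brick. If `U ≠ T`, torsion decompositions (`star_rightOrthogonal`) show that such an `S` exists.
This gives (1), and (2) follows by applying it to both halves of `U ≤ V ≤ T`.

For (3), if `T` covers `U`, any nonzero `F` in `Uᗮ ⊓ T` generates `T` over `U`, so a quotient of `F`
maps nontrivially to any other nonzero object there (`exists_ne_zero_from_fac`). Mapping to `S` and
from `S` shows that `S` is a quotient and a subobject of each brick.

These image arguments need a zero deflation to have zero target, and dually. This follows from the
splitting of idempotents, itself a consequence of admissibility. -/

theorem IsTriangle.of_iso {X Y Y' Z : C} {x : X ⟶ Y} {y : Y ⟶ Z} {δ : 𝔼.Ext Z X}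
    (hδ : 𝔼.IsTriangle x y δ) (e : Y ≅ Y') {x' : X ⟶ Y'} {y' : Y' ⟶ Z}
    (hx : x ≫ e.hom = x') (hy : e.hom ≫ y' = y) : 𝔼.IsTriangle x' y' δ := by
  have hs : 𝔼.s δ = _ := hδ
  exact hs.trans (Quotient.sound ⟨e, hx, hy⟩)

theorem IsTriangle.exists_iso {X Y Y' Z : C} {x : X ⟶ Y} {y : Y ⟶ Z} {δ : 𝔼.Ext Z X}
    {x' : X ⟶ Y'} {y' : Y' ⟶ Z} (hδ : 𝔼.IsTriangle x y δ) (hδ' : 𝔼.IsTriangle x' y' δ) :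
    ∃ e : Y ≅ Y', x ≫ e.hom = x' ∧ e.hom ≫ y' = y := by
  have hs : 𝔼.s δ = _ := hδ
  have hs' : 𝔼.s δ = _ := hδ'
  exact Quotient.exact (hs.symm.trans hs')

variable [Preadditive C] [HasBinaryBiproducts C]

namespace IsExtriangulated

variable (h : 𝔼.IsExtriangulated)
include h

theorem ext_eq_zero_of_isZero {Z X : C} (hZ : IsZero Z) (δ : 𝔼.Ext Z X) : δ = 0 := by
  have := h.additive_left
  have hid : 𝔼.pull (𝟙 Z) δ = δ := by simp [pull]
  have hzero : 𝔼.pull (0 : Z ⟶ Z) δ = 0 := by simp [pull]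
  rw [← hid, hZ.eq_of_src (𝟙 Z) 0, hzero]

theorem isTriangle_iso_zero {X Y Z : C} (e : X ≅ Y) (hZ : IsZero Z) :
    𝔼.IsTriangle e.hom (0 : Y ⟶ Z) 0 := by
  refine (h.realize_zero X Z).of_iso
    ⟨biprod.fst ≫ e.hom, e.inv ≫ biprod.inl, ?_, by simp⟩ (by simp) (hZ.eq_of_tgt _ _)
  ext
  · simp
  · exact hZ.eq_of_tgt _ _
  · exact hZ.eq_of_src _ _
  · exact hZ.eq_of_src _ _

theorem isTriangle_zero_iso {X Y Z : C} (e : Y ≅ Z) (hX : IsZero X) :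
    𝔼.IsTriangle (0 : X ⟶ Y) e.hom 0 := by
  refine (h.realize_zero X Z).of_iso
    ⟨biprod.snd ≫ e.inv, e.hom ≫ biprod.inr, ?_, by simp⟩ (hX.eq_of_src _ _) (by simp)
  ext
  · exact hX.eq_of_src _ _
  · exact hX.eq_of_src _ _
  · exact hX.eq_of_tgt _ _
  · simp

theorem isIso_of_isZero_right {X Y Z : C} {x : X ⟶ Y} {y : Y ⟶ Z} {δ : 𝔼.Ext Z X}
    (hδ : 𝔼.IsTriangle x y δ) (hZ : IsZero Z) : IsIso x := by
  rw [h.ext_eq_zero_of_isZero hZ δ] at hδ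
  obtain ⟨e, he, -⟩ := (h.isTriangle_iso_zero (Iso.refl X) hZ).exists_iso hδ
  rw [← he]
  infer_instance

theorem ext_eq_zero_of_isZero_left {Z X : C} (hX : IsZero X) (δ : 𝔼.Ext Z X) : δ = 0 := by
  have := h.additive_right (op Z)
  have hid : 𝔼.push (𝟙 X) δ = δ := by simp [push]
  have hzero : 𝔼.push (0 : X ⟶ X) δ = 0 := by simp [push]
  rw [← hid, hX.eq_of_src (𝟙 X) 0, hzero]

theorem isIso_of_isZero_left {X Y Z : C} {x : X ⟶ Y} {y : Y ⟶ Z} {δ : 𝔼.Ext Z X}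
    (hδ : 𝔼.IsTriangle x y δ) (hX : IsZero X) : IsIso y := by
  rw [h.ext_eq_zero_of_isZero_left hX δ] at hδ
  obtain ⟨e, -, he⟩ := hδ.exists_iso (h.isTriangle_zero_iso (Iso.refl Z) hX)
  rw [← he]
  infer_instance

variable [HasZeroObject C]

open ZeroObject

/-- (ET3) applied to a map into the trivial triangle on `W`. The factorization need not be unique.
-/
theorem exists_desc {X Y Z W : C} {x : X ⟶ Y} {y : Y ⟶ Z} {δ : 𝔼.Ext Z X}
    (hδ : 𝔼.IsTriangle x y δ) (f : Y ⟶ W) (hf : x ≫ f = 0) : ∃ g : Z ⟶ W, y ≫ g = f := by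
  obtain ⟨g, hg, -⟩ := h.et3 hδ (h.isTriangle_zero_iso (Iso.refl W) (isZero_zero C)) 0 f
    (by simp [hf])
  exact ⟨g, by simpa using hg⟩

theorem exists_lift {X Y Z W : C} {x : X ⟶ Y} {y : Y ⟶ Z} {δ : 𝔼.Ext Z X}
    (hδ : 𝔼.IsTriangle x y δ) (f : W ⟶ Y) (hf : f ≫ y = 0) : ∃ g : W ⟶ X, g ≫ x = f := by
  obtain ⟨g, hg, -⟩ := h.et3_op (h.isTriangle_iso_zero (Iso.refl W) (isZero_zero C)) hδ f 0
    (by simp [hf])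
  exact ⟨g, by simpa using hg.symm⟩

end IsExtriangulated

/-! ### Inflations and deflations in a length category -/

namespace IsLengthCategory

variable (h : 𝔼.IsLengthCategory Θ)
include h

theorem length_eq_zero {X : C} (hX : IsZero X) : Θ X = 0 :=
  (h.lengthFunction.eq_zero_iff X).2 hX

theorem length_biprod (X Y : C) : Θ (X ⊞ Y) = Θ X + Θ Y :=
  h.lengthFunction.eq_add_of_split (h.extriangulated.realize_zero X Y)

/-- (ET4) supplies the triangles. Stability is automatic: subadditivity bounds the lengths from both
sides, forcing equality. -/
theorem isInflation_comp {X Y Z : C} {f : X ⟶ Y} {g : Y ⟶ Z} (hf : 𝔼.IsInflation Θ f)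
    (hg : 𝔼.IsInflation Θ g) : 𝔼.IsInflation Θ (f ≫ g) := by
  obtain ⟨D, f', δ, hδ, hΘ⟩ := hf
  obtain ⟨F, g', δ', hδ', hΘ'⟩ := hg
  obtain ⟨G, h', d, e, δ'', h₁, -, -, h₂, -, -⟩ := h.extriangulated.et4 hδ hδ'
  have l₁ := h.lengthFunction.le_add h₁
  have l₂ := h.lengthFunction.le_add h₂
  exact ⟨G, h', δ'', h₁, by omega⟩

/-- Pulling back a stable `𝔼`-triangle along an inflation. -/
theorem exists_pullback {X Y Z Q I : C} {x : X ⟶ Y} {y : Y ⟶ Z} {δ : 𝔼.Ext Z X}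
    (hy : 𝔼.IsStableTriangle Θ x y δ) {j : I ⟶ Z} {q : Z ⟶ Q} {δ' : 𝔼.Ext Q I}
    (hj : 𝔼.IsStableTriangle Θ j q δ') :
    ∃ (G : C) (k : G ⟶ Y) (d : X ⟶ G) (e : G ⟶ I) (ε : 𝔼.Ext Q G) (ε' : 𝔼.Ext I X),
      𝔼.IsStableTriangle Θ k (y ≫ q) ε ∧ 𝔼.IsStableTriangle Θ d e ε' := by
  obtain ⟨hδ, hΘ⟩ := hy
  obtain ⟨hδ', hΘ'⟩ := hj
  obtain ⟨G, k, d, e, ε, h₁, -, -, h₂, -, -⟩ := h.extriangulated.et4_op hδ hδ'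
  have l₁ := h.lengthFunction.le_add h₁
  have l₂ := h.lengthFunction.le_add h₂
  exact ⟨G, k, d, e, ε, _, ⟨h₁, by omega⟩, ⟨h₂, by omega⟩⟩

theorem isDeflation_comp {X Y Z : C} {f : X ⟶ Y} {g : Y ⟶ Z} (hf : 𝔼.IsDeflation Θ f)
    (hg : 𝔼.IsDeflation Θ g) : 𝔼.IsDeflation Θ (f ≫ g) := by
  obtain ⟨_, _, _, hδ⟩ := hf
  obtain ⟨_, _, _, hδ'⟩ := hg
  obtain ⟨G, k, -, -, ε, -, hk, -⟩ := h.exists_pullback hδ hδ'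
  exact ⟨G, k, ε, hk⟩

omit [Preadditive C] [HasBinaryBiproducts C] h in
theorem _root_.ExtriLength.ExtriData.IsInflation.length_le {X Y : C} {f : X ⟶ Y}
    (hf : 𝔼.IsInflation Θ f) : Θ X ≤ Θ Y := by
  obtain ⟨_, _, _, _, hΘ⟩ := hf
  omega

omit [Preadditive C] [HasBinaryBiproducts C] h in
theorem _root_.ExtriLength.ExtriData.IsDeflation.length_le {X Y : C} {f : X ⟶ Y}
    (hf : 𝔼.IsDeflation Θ f) : Θ Y ≤ Θ X := by
  obtain ⟨_, _, _, _, hΘ⟩ := hf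
  omega

theorem isIso_of_isInflation {X Y : C} {f : X ⟶ Y} (hf : 𝔼.IsInflation Θ f)
    (hle : Θ Y ≤ Θ X) : IsIso f := by
  obtain ⟨Z, _, _, hδ, hΘ⟩ := hf
  exact h.extriangulated.isIso_of_isZero_right hδ
    ((h.lengthFunction.eq_zero_iff Z).1 (by omega))

theorem isIso_of_isDeflation {X Y : C} {f : X ⟶ Y} (hf : 𝔼.IsDeflation Θ f)
    (hle : Θ X ≤ Θ Y) : IsIso f := by
  obtain ⟨Z, _, _, hδ, hΘ⟩ := hf
  exact h.extriangulated.isIso_of_isZero_left hδ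
    ((h.lengthFunction.eq_zero_iff Z).1 (by omega))

/-- Idempotents split in a length category. -/
theorem exists_split_of_idempotent {K : C} (f : K ⟶ K) (hf : f ≫ f = f) :
    ∃ (L : C) (a : K ⟶ L) (b : L ⟶ K), a ≫ b = f ∧ b ≫ a = 𝟙 L := by
  induction hn : Θ K using Nat.strong_induction_on generalizing K with
  | _ n ih =>
    obtain ⟨J, i, j, hi, hj, rfl⟩ := h.admissible f
    rcases hi.length_le.lt_or_eq with hlt | heq
    -- With `g = j ≫ i` on the shorter object `J`, idempotence of `i ≫ j` gives `g³ = g²`. Thus `g²`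
    -- is idempotent, and its splitting transports to `K` along `i` and `j`.
    · have hg : (j ≫ i) ≫ (j ≫ i) ≫ (j ≫ i) = (j ≫ i) ≫ (j ≫ i) := by
        simpa using congr(j ≫ $hf ≫ i)
      obtain ⟨L, a, b, hab, hba⟩ := ih (Θ J) (by omega) ((j ≫ i) ≫ (j ≫ i))
        (by rw [Category.assoc, hg, hg]) rfl
      have hb : b ≫ (j ≫ i) ≫ (j ≫ i) = b := by rw [← hab, reassoc_of% hba]
      refine ⟨L, i ≫ a, b ≫ j, ?_, ?_⟩
      · calc (i ≫ a) ≫ b ≫ j = i ≫ (a ≫ b) ≫ j := by simp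
          _ = (i ≫ j) ≫ (i ≫ j) ≫ (i ≫ j) := by rw [hab]; simp
          _ = i ≫ j := by rw [hf, hf]
      · calc (b ≫ j) ≫ i ≫ a = (b ≫ (j ≫ i) ≫ (j ≫ i)) ≫ (j ≫ i) ≫ a := by rw [hb]; simp
          _ = b ≫ ((j ≫ i) ≫ (j ≫ i) ≫ (j ≫ i)) ≫ a := by simp
          _ = b ≫ a := by rw [hg, ← Category.assoc, hb]
          _ = 𝟙 L := hba
    -- Here `i ≫ j` is invertible, and an invertible idempotent is the identity.
    · have := h.isIso_of_isDeflation hi heq.ge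
      have := h.isIso_of_isInflation hj heq.ge
      refine ⟨K, 𝟙 K, 𝟙 K, ?_, by simp⟩
      rw [← cancel_epi (i ≫ j), hf]
      simp

/-- A retract is not longer than the object it is a retract of. -/
theorem length_le_of_retract {Y K : C} {s : Y ⟶ K} {x : K ⟶ Y} (hs : s ≫ x = 𝟙 Y) :
    Θ Y ≤ Θ K := by
  -- Splitting the complementary idempotent yields `K ≅ Y ⊞ L`, on which `Θ` is additive.
  obtain ⟨L, a, b, hab, hba⟩ := h.exists_split_of_idempotent (𝟙 K - x ≫ s)
    (by simp [reassoc_of% hs])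
  have hsa : s ≫ a = 0 := by
    calc s ≫ a = s ≫ (a ≫ b) ≫ a := by simp [hba]
      _ = 0 := by rw [hab]; simp [reassoc_of% hs]
  have hbx : b ≫ x = 0 := by
    calc b ≫ x = b ≫ (a ≫ b) ≫ x := by simp [reassoc_of% hba]
      _ = 0 := by rw [hab]; simp [hs]
  have e : K ≅ Y ⊞ L :=
    { hom := biprod.lift x a
      inv := biprod.desc s b
      hom_inv_id := by simp [hab]
      inv_hom_id := by ext <;> simp [hs, hsa, hbx, hba] }
  have := h.lengthFunction.iso_inv e
  have := h.length_biprod Y L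
  omega

section HasZeroObject

variable [HasZeroObject C]

open ZeroObject

theorem isInflation_of_iso {X Y : C} (e : X ≅ Y) : 𝔼.IsInflation Θ e.hom :=
  ⟨0, 0, 0, h.extriangulated.isTriangle_iso_zero e (isZero_zero C), by
    rw [h.length_eq_zero (isZero_zero C), h.lengthFunction.iso_inv e, add_zero]⟩

theorem isDeflation_of_iso {X Y : C} (e : X ≅ Y) : 𝔼.IsDeflation Θ e.hom :=
  ⟨0, 0, 0, h.extriangulated.isTriangle_zero_iso e (isZero_zero C), by
    rw [h.length_eq_zero (isZero_zero C), h.lengthFunction.iso_inv e, zero_add]⟩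

omit [HasZeroObject C] in
theorem isDeflation_to_zero {X Z : C} (hZ : IsZero Z) : 𝔼.IsDeflation Θ (0 : X ⟶ Z) :=
  ⟨X, _, 0, h.extriangulated.isTriangle_iso_zero (Iso.refl X) hZ, by
    rw [h.length_eq_zero hZ, add_zero]⟩

/-- The identity of `Y` lifts through `K ⟶ Y`, so `Y` is a retract of `K` and `Θ Y ≤ Θ K`; stability
leaves `Θ Q = 0`. -/
theorem isZero_of_isDeflation_zero {Y Q : C} (hy : 𝔼.IsDeflation Θ (0 : Y ⟶ Q)) :
    IsZero Q := by
  obtain ⟨K, x, δ, hδ, hΘ⟩ := hy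
  obtain ⟨s, hs⟩ := h.extriangulated.exists_lift hδ (𝟙 Y) (by simp)
  have := h.length_le_of_retract hs
  exact (h.lengthFunction.eq_zero_iff Q).1 (by omega)

theorem isZero_of_isInflation_zero {X Y : C} (hx : 𝔼.IsInflation Θ (0 : X ⟶ Y)) :
    IsZero X := by
  obtain ⟨Q, y, δ, hδ, hΘ⟩ := hx
  obtain ⟨r, hr⟩ := h.extriangulated.exists_desc hδ (𝟙 Y) (by simp)
  have := h.length_le_of_retract hr
  exact (h.lengthFunction.eq_zero_iff X).1 (by omega)

/-! ### Torsion classes and orthogonals -/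

theorem le_fac (P : ObjectProperty C) : P ≤ 𝔼.Fac Θ P :=
  fun M hM => ⟨M, 𝟙 M, hM, h.isDeflation_of_iso (Iso.refl M)⟩

omit [HasZeroObject C] in
theorem fac_fac_le (P : ObjectProperty C) : 𝔼.Fac Θ (𝔼.Fac Θ P) ≤ 𝔼.Fac Θ P := by
  rintro M ⟨N, y, ⟨L, z, hL, hz⟩, hy⟩
  exact ⟨L, z ≫ y, hL, h.isDeflation_comp hz hy⟩

/-- The image of a map from `P` to `M` is again in `P`, so it includes into `N` by a zero inflation
and vanishes. -/
theorem sub_rightOrthogonal_le {P : ObjectProperty C} (hP : 𝔼.Fac Θ P ≤ P) :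
    𝔼.Sub Θ P.rightOrthogonal ≤ P.rightOrthogonal := by
  rintro M ⟨N, x, hN, hx⟩ Y f hY
  obtain ⟨J, i, j, hi, hj, rfl⟩ := h.admissible f
  have hJ : j ≫ x = 0 := hN (j ≫ x) (hP _ ⟨Y, i, hY, hi⟩)
  have hz := h.isInflation_comp hj hx
  rw [hJ] at hz
  rw [(h.isZero_of_isInflation_zero hz).eq_of_tgt i 0, zero_comp]

/-- The left orthogonal of a subcategory closed under subobjects is a torsion class. -/
theorem isTorsionClass_leftOrthogonal {Q : ObjectProperty C} (hQ : 𝔼.Sub Θ Q ≤ Q) :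
    𝔼.IsTorsionClass Θ Q.leftOrthogonal where
  nonempty := ⟨0, fun _ _ _ => (isZero_zero C).eq_of_src _ _⟩
  isoClosed := inferInstance
  fac_le := by
    rintro N ⟨M, y, hM, hy⟩ Y f hY
    obtain ⟨J, i, j, hi, hj, rfl⟩ := h.admissible f
    have hJ : y ≫ i = 0 := hM (y ≫ i) (hQ _ ⟨Y, j, hY, hj⟩)
    have hz := h.isDeflation_comp hy hi
    rw [hJ] at hz
    rw [(h.isZero_of_isDeflation_zero hz).eq_of_tgt i 0, zero_comp]
  star_le := by
    rintro M ⟨X, Z, x, y, δ, hX, hZ, hδ, -⟩ Y f hY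
    obtain ⟨g, rfl⟩ := h.extriangulated.exists_desc hδ f (hX _ hY)
    rw [hZ g hY, comp_zero]

end HasZeroObject

end IsLengthCategory

omit [Preadditive C] [HasBinaryBiproducts C] in
theorem IsTorsionClass.inf {T T' : ObjectProperty C} (hT : 𝔼.IsTorsionClass Θ T)
    (hT' : 𝔼.IsTorsionClass Θ T') (hne : ∃ X, (T ⊓ T') X) :
    𝔼.IsTorsionClass Θ (T ⊓ T') where
  nonempty := hne
  isoClosed := ⟨fun e hX => ⟨hT.isoClosed.of_iso e hX.1, hT'.isoClosed.of_iso e hX.2⟩⟩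
  fac_le := by
    rintro M ⟨N, y, hN, hy⟩
    exact ⟨hT.fac_le _ ⟨N, y, hN.1, hy⟩, hT'.fac_le _ ⟨N, y, hN.2, hy⟩⟩
  star_le := by
    rintro M ⟨X, Z, x, y, δ, hX, hZ, hδ⟩
    exact ⟨hT.star_le _ ⟨X, Z, x, y, δ, hX.1, hZ.1, hδ⟩,
      hT'.star_le _ ⟨X, Z, x, y, δ, hX.2, hZ.2, hδ⟩⟩

omit [Preadditive C] [HasBinaryBiproducts C] in
theorem isTorsionClass_torsionClosure {P : ObjectProperty C} (hP : ∃ X, P X) :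
    𝔼.IsTorsionClass Θ (𝔼.torsionClosure Θ P) where
  nonempty := hP.imp fun _ hX _ _ hPT => hPT _ hX
  isoClosed := ⟨fun e hX T hT hPT => hT.isoClosed.of_iso e (hX T hT hPT)⟩
  fac_le := by
    rintro M ⟨N, y, hN, hy⟩ T hT hPT
    exact hT.fac_le _ ⟨N, y, hN T hT hPT, hy⟩
  star_le := by
    rintro M ⟨X, Z, x, y, δ, hX, hZ, hδ⟩ T hT hPT
    exact hT.star_le _ ⟨X, Z, x, y, δ, hX T hT hPT, hZ T hT hPT, hδ⟩

namespace IsLengthCategory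

variable [HasZeroObject C] (h : 𝔼.IsLengthCategory Θ)
include h

open ZeroObject

omit [HasZeroObject C] in
theorem mem_of_isZero {T : ObjectProperty C} (hT : 𝔼.IsTorsionClass Θ T) {Z : C}
    (hZ : IsZero Z) : T Z := by
  obtain ⟨X, hX⟩ := hT.nonempty
  exact hT.fac_le _ ⟨X, 0, hX, h.isDeflation_to_zero hZ⟩

/-- Every object has a torsion part and a torsion-free quotient. -/
theorem star_rightOrthogonal {T : ObjectProperty C} (hT : 𝔼.IsTorsionClass Θ T) (M : C) :
    𝔼.star Θ T T.rightOrthogonal M := by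
  classical
  -- The torsion part is a `T`-subobject of `M` of maximal length.
  let p : ℕ → Prop := fun n => ∃ (X : C) (x : X ⟶ M), T X ∧ 𝔼.IsInflation Θ x ∧ Θ X = n
  have hbound : ∀ n, p n → n ≤ Θ M := by
    rintro n ⟨X, x, -, hx, rfl⟩
    exact hx.length_le
  have hp0 : p 0 := ⟨0, 0, h.mem_of_isZero hT (isZero_zero C),
    ⟨M, _, 0, h.extriangulated.isTriangle_zero_iso (Iso.refl M) (isZero_zero C), by
      rw [h.length_eq_zero (isZero_zero C), zero_add]⟩, h.length_eq_zero (isZero_zero C)⟩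
  obtain ⟨X, x, hX, ⟨F, y, δ, hδ⟩, hn⟩ := Nat.findGreatest_spec (Nat.zero_le (Θ M)) hp0
  refine ⟨X, F, x, y, δ, hX, fun Y f hY => ?_, hδ⟩
  obtain ⟨I, i, j, hi, ⟨Q, q, δ', hj⟩, rfl⟩ := h.admissible f
  -- The preimage `G` in `M` of the image `I` is an extension of `I` by `X`, hence in `T`;
  -- maximality of `Θ X` forces `I` to vanish.
  obtain ⟨G, k, d, e, ε, ε', hk, hd⟩ := h.exists_pullback hδ hj
  have hG : p (Θ G) := ⟨G, k,
    hT.star_le _ ⟨X, I, d, e, ε', hX, hT.fac_le _ ⟨Y, i, hY, hi⟩, hd⟩, ⟨Q, _, ε, hk⟩, rfl⟩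
  have hle := Nat.le_findGreatest (hbound _ hG) hG
  have hI : IsZero I := (h.lengthFunction.eq_zero_iff I).1 (by
    have := hd.2
    omega)
  rw [hI.eq_of_tgt i 0, zero_comp]

/-- An object of `T` outside `U` has a nonzero quotient in `Uᗮ ⊓ T`. -/
theorem exists_deflation_of_not_mem {U T : ObjectProperty C} (hU : 𝔼.IsTorsionClass Θ U)
    (hT : 𝔼.IsTorsionClass Θ T) {M : C} (hM : T M) (hMU : ¬ U M) :
    ∃ (F : C) (y : M ⟶ F), 𝔼.IsDeflation Θ y ∧ (U.rightOrthogonal ⊓ T) F ∧ ¬ IsZero F := by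
  obtain ⟨X, F, x, y, δ, hX, hF, hδ⟩ := h.star_rightOrthogonal hU M
  refine ⟨F, y, ⟨X, x, δ, hδ⟩, ⟨hF, hT.fac_le _ ⟨M, y, hM, X, x, δ, hδ⟩⟩, fun hz => hMU ?_⟩
  have := h.extriangulated.isIso_of_isZero_right hδ.1 hz
  exact hU.isoClosed.of_iso (asIso x) hX

end IsLengthCategory

/-! ### Objects of minimal length in `Uᗮ ⊓ T` -/

omit [HasBinaryBiproducts C] in
theorem _root_.ExtriLength.IsBrick.not_isZero {S : C} (hS : IsBrick S) : ¬ IsZero S := by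
  intro hz
  have := hS.1
  exact one_ne_zero (α := End S) (hz.eq_of_src _ _)

variable (Θ) in
/-- A nonzero object of minimal length in a subcategory. -/
structure IsShortest (P : ObjectProperty C) (S : C) : Prop where
  mem : P S
  not_isZero : ¬ IsZero S
  length_le : ∀ X, P X → ¬ IsZero X → Θ S ≤ Θ X

omit [Preadditive C] [HasBinaryBiproducts C] in
theorem exists_isShortest {P : ObjectProperty C} (hP : ∃ X, P X ∧ ¬ IsZero X) :
    ∃ S, IsShortest Θ P S := by
  classical
  have hex : ∃ n X, P X ∧ ¬ IsZero X ∧ Θ X = n := by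
    obtain ⟨X, hX, hX0⟩ := hP
    exact ⟨Θ X, X, hX, hX0, rfl⟩
  obtain ⟨S, hS, hS0, hΘ⟩ := Nat.find_spec hex
  refine ⟨S, hS, hS0, fun X hX hX0 => ?_⟩
  rw [hΘ]
  exact Nat.find_min' hex ⟨X, hX, hX0, rfl⟩

namespace IsLengthCategory

variable [HasZeroObject C] (h : 𝔼.IsLengthCategory Θ)
  {U T : ObjectProperty C} (hU : 𝔼.IsTorsionClass Θ U) (hT : 𝔼.IsTorsionClass Θ T)
include h hU hT

/-- A nonzero morphism from an object of `T` to a shortest object of `Uᗮ ⊓ T` is a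
deflation. -/
theorem isDeflation_of_isShortest {S X : C} (hS : IsShortest Θ (U.rightOrthogonal ⊓ T) S)
    (hX : T X) (f : X ⟶ S) (hf : f ≠ 0) : 𝔼.IsDeflation Θ f := by
  obtain ⟨J, i, j, hi, hj, rfl⟩ := h.admissible f
  have hJ0 : ¬ IsZero J := fun hz => hf (by rw [hz.eq_of_tgt i 0, zero_comp])
  have := h.isIso_of_isInflation hj (hS.length_le J
    ⟨h.sub_rightOrthogonal_le hU.fac_le _ ⟨S, j, hS.mem.1, hj⟩,
      hT.fac_le _ ⟨X, i, hX, hi⟩⟩ hJ0)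
  exact h.isDeflation_comp hi (h.isDeflation_of_iso (asIso j))

theorem isBrick_of_isShortest {S : C} (hS : IsShortest Θ (U.rightOrthogonal ⊓ T) S) :
    IsBrick S := by
  refine ⟨⟨1, 0, fun h1 => hS.not_isZero ((IsZero.iff_id_eq_zero S).2 h1)⟩, fun f hf => ?_⟩
  have : IsIso (f : S ⟶ S) :=
    h.isIso_of_isDeflation (h.isDeflation_of_isShortest hU hT hS hS.mem.2 f hf) le_rfl
  exact (isUnit_iff_isIso f).2 this

theorem exists_isShortest_of_ne (hUT : U ≤ T) (hne : U ≠ T) :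
    ∃ S, IsShortest Θ (U.rightOrthogonal ⊓ T) S := by
  obtain ⟨M, hM, hMU⟩ : ∃ M, T M ∧ ¬ U M := by
    by_contra! hno
    exact hne (le_antisymm hUT hno)
  obtain ⟨F, -, -, hF, hF0⟩ := h.exists_deflation_of_not_mem hU hT hM hMU
  exact exists_isShortest ⟨F, hF, hF0⟩

/-- If `T` covers `U`, then every nonzero object of `Uᗮ ⊓ T` receives a nonzero morphism from a
quotient of any other such object. -/
theorem exists_ne_zero_from_fac (hUT : U ≤ T)
    (hcover : ∀ V, 𝔼.IsTorsionClass Θ V → U ≤ V → V ≤ T → V ≠ U → V = T)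
    {F X : C} (hF : (U.rightOrthogonal ⊓ T) F) (hF0 : ¬ IsZero F)
    (hX : (U.rightOrthogonal ⊓ T) X) (hX0 : ¬ IsZero X) :
    ∃ (F' : C) (y : F ⟶ F') (f : F' ⟶ X), 𝔼.IsDeflation Θ y ∧ f ≠ 0 := by
  -- The double orthogonal of the quotient-closed `P` is a torsion class containing `U` and `F`. Its
  -- intersection with `T` is not `U`, since `F` is nonzero in `Uᗮ`, so it is `T`.
  let P := 𝔼.Fac Θ (U ⊔ ObjectProperty.singleton F)
  have hP : 𝔼.Fac Θ P ≤ P := h.fac_fac_le _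
  have hle : P ≤ P.rightOrthogonal.leftOrthogonal := fun Y hY Z f hZ => hZ f hY
  have hV := h.isTorsionClass_leftOrthogonal (h.sub_rightOrthogonal_le hP)
  have hUV : U ≤ P.rightOrthogonal.leftOrthogonal :=
    le_sup_left.trans ((h.le_fac _).trans hle)
  have hFV : P.rightOrthogonal.leftOrthogonal F :=
    hle _ (h.le_fac _ _ (Or.inr (ObjectProperty.singleton_le_iff.1 le_rfl)))
  have hVT := hcover _ (hT.inf hV ⟨F, hF.2, hFV⟩) (le_inf hUT hUV) inf_le_left (by
    intro heq
    have hFU : U F := by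
      rw [← heq]
      exact ⟨hF.2, hFV⟩
    exact hF0 ((IsZero.iff_id_eq_zero F).2 (hF.1 (𝟙 F) hFU)))
  have hXV : P.rightOrthogonal.leftOrthogonal X := by
    have hX2 := hX.2
    rw [← hVT] at hX2
    exact hX2.2
  by_contra! hno
  -- Without such a map, `X` lies in `Pᗮ` as well as in its left orthogonal, so its identity
  -- vanishes.
  refine hX0 ((IsZero.iff_id_eq_zero X).2 (hXV (𝟙 X) ?_))
  rintro Y f ⟨Z, y, hZ | hZ, hy⟩
  · exact hX.1 f (hU.fac_le _ ⟨Z, y, hZ, hy⟩)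
  · obtain rfl := (ObjectProperty.singleton_iff _ _).1 hZ
    exact hno Y y f hy

end IsLengthCategory

end ExtriData

end ExtriLength

/-! ### Intervals of torsion classes and their bricks -/

open ExtriLength ExtriLength.ExtriData in
theorem theorem4 {C : Type u} [Category.{v} C] [Preadditive C]
    [HasFiniteBiproducts C] [HasBinaryBiproducts C]
    (hC : ExtriLength.IsKrullSchmidt C)
    (𝔼 : ExtriLength.ExtriData.{w} C) (Θ : C → ℕ) (h : 𝔼.IsLengthCategory Θ)
    (U T : 𝔼.Tors Θ) (hUT : U ≤ T) :
    ((Set.Icc U T).encard = 1 ↔ ExtriLength.brick (U.1.rightOrthogonal ⊓ T.1) = ∅) ∧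
    ((ExtriLength.brick (U.1.rightOrthogonal ⊓ T.1)).encard = 1 →
      (Set.Icc U T).encard = 2) ∧
    ((Set.Icc U T).encard = 2 →
      ∃ S : C, ExtriLength.IsBrick S ∧ (U.1.rightOrthogonal ⊓ T.1) S ∧
        (∀ S' : C, ExtriLength.IsBrick S' → (U.1.rightOrthogonal ⊓ T.1) S' → Θ S ≤ Θ S') ∧
        (T.1 = 𝔼.torsionClosure Θ (U.1 ⊔ ObjectProperty.singleton S) ∧
          U.1 = T.1 ⊓ (ObjectProperty.singleton S).leftOrthogonal) ∧
        (∀ S' : C, ExtriLength.IsBrick S' → (U.1.rightOrthogonal ⊓ T.1) S' →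
          𝔼.Sub Θ (ObjectProperty.singleton S') S ∧
          𝔼.Fac Θ (ObjectProperty.singleton S') S) ∧
        -- uniqueness up to isomorphism, already among the bricks of minimal length
        (∀ S₁ : C, ExtriLength.IsBrick S₁ → (U.1.rightOrthogonal ⊓ T.1) S₁ →
          (∀ S' : C, ExtriLength.IsBrick S' → (U.1.rightOrthogonal ⊓ T.1) S' → Θ S₁ ≤ Θ S') →
          Nonempty (S₁ ≅ S))) := by
  have hmem {V : 𝔼.Tors Θ} {S : C} (hS : IsBrick S) (hVS : V.1.rightOrthogonal S) : ¬ V.1 S :=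
    fun hV => hS.not_isZero ((IsZero.iff_id_eq_zero S).2 (hVS (𝟙 S) hV))
  have hUmem : U ∈ Set.Icc U T := ⟨le_rfl, hUT⟩
  have hTmem : T ∈ Set.Icc U T := ⟨hUT, le_rfl⟩
  have hone : (Set.Icc U T).encard = 1 ↔ U = T := by
    constructor
    · intro hcard
      exact Set.encard_le_one_iff.1 hcard.le _ _ hUmem hTmem
    · rintro rfl
      simp
  have hshort {V W : 𝔼.Tors Θ} (hVW : V ≤ W) (hne : V ≠ W) :
      ∃ S, IsShortest Θ (V.1.rightOrthogonal ⊓ W.1) S :=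
    h.exists_isShortest_of_ne V.2 W.2 hVW fun heq => hne (Subtype.ext heq)
  refine ⟨?_, ?_, ?_⟩
  · rw [hone]
    constructor
    · rintro rfl
      refine Set.eq_empty_iff_forall_notMem.2 ?_
      rintro _ ⟨S, hS, hSU, rfl⟩
      exact hmem hS hSU.1 hSU.2
    · intro hempty
      by_contra hne
      obtain ⟨S, hS⟩ := hshort hUT hne
      have hq : Quotient.mk (isIsomorphicSetoid C) S ∈ brick (U.1.rightOrthogonal ⊓ T.1) :=
        ⟨S, h.isBrick_of_isShortest U.2 T.2 hS, hS.mem, rfl⟩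
      rw [hempty] at hq
      exact hq
  · intro hcard
    have hsub := Set.encard_le_one_iff.1 hcard.le
    have hne : U ≠ T := by
      rintro rfl
      obtain ⟨q, hq⟩ := Set.encard_eq_one.1 hcard
      obtain ⟨S, hS, hSU, -⟩ : q ∈ brick (U.1.rightOrthogonal ⊓ U.1) := by
        rw [hq]
        exact Set.mem_singleton q
      exact hmem hS hSU.1 hSU.2
    refine Set.encard_eq_two.2 ⟨U, T, hne, Set.Subset.antisymm ?_ ?_⟩
    · rintro V ⟨hUV, hVT⟩
      by_contra! hV
      simp only [Set.mem_insert_iff, Set.mem_singleton_iff, not_or] at hV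
      -- A third class `V` gives bricks `B` in `V` and `B'` in `Vᗮ`, both in `Uᗮ ⊓ T`. Being the
      -- same brick, they would place a nonzero object in `V ⊓ Vᗮ`.
      obtain ⟨B, hB⟩ := hshort hUV (Ne.symm hV.1)
      obtain ⟨B', hB'⟩ := hshort hVT hV.2
      have hBrick := h.isBrick_of_isShortest U.2 V.2 hB
      have hBrick' := h.isBrick_of_isShortest V.2 T.2 hB'
      obtain ⟨e⟩ := Quotient.exact (hsub _ _ ⟨B, hBrick, ⟨hB.mem.1, hVT _ hB.mem.2⟩, rfl⟩
        ⟨B', hBrick', ⟨fun _ f hX => hB'.mem.1 f (hUV _ hX), hB'.mem.2⟩, rfl⟩)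
      exact hmem hBrick' hB'.mem.1 (V.2.isoClosed.of_iso e hB.mem.2)
    · rintro V (rfl | rfl)
      · exact hUmem
      · exact hTmem
  · intro hcard
    have hne : U ≠ T := by
      rintro rfl
      rw [hone.2 rfl] at hcard
      exact absurd hcard (by norm_num)
    have hcover : ∀ V, 𝔼.IsTorsionClass Θ V → U.1 ≤ V → V ≤ T.1 → V ≠ U.1 → V = T.1 := by
      intro V hV hUV hVT hVU
      obtain ⟨A, B, -, hAB⟩ := Set.encard_eq_two.1 hcard
      have hVmem : (⟨V, hV⟩ : 𝔼.Tors Θ) ∈ Set.Icc U T := ⟨hUV, hVT⟩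
      have hVU' : (⟨V, hV⟩ : 𝔼.Tors Θ) ≠ U := fun heq => hVU (congrArg Subtype.val heq)
      suffices heq : (⟨V, hV⟩ : 𝔼.Tors Θ) = T from congrArg Subtype.val heq
      rw [hAB] at hUmem hTmem hVmem
      grind
    obtain ⟨S, hS⟩ := hshort hUT hne
    have hBrick := h.isBrick_of_isShortest U.2 T.2 hS
    have hfac {F : C} (hF : (U.1.rightOrthogonal ⊓ T.1) F) (hF0 : ¬ IsZero F) :
        ∃ f : F ⟶ S, 𝔼.IsDeflation Θ f := by
      obtain ⟨F', y, f, hy, hf⟩ := h.exists_ne_zero_from_fac U.2 T.2 hUT hcover hF hF0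
        hS.mem hS.not_isZero
      exact ⟨y ≫ f, h.isDeflation_comp hy
        (h.isDeflation_of_isShortest U.2 T.2 hS (T.2.fac_le _ ⟨F, y, hF.2, hy⟩) f hf)⟩
    have hsingle (X : C) : ObjectProperty.singleton X X :=
      (ObjectProperty.singleton_iff X X).2 rfl
    refine ⟨S, hBrick, hS.mem, fun S' hS' hmem' => hS.length_le S' hmem' hS'.not_isZero,
      ⟨?_, ?_⟩, ?_, ?_⟩
    · refine (hcover _ (isTorsionClass_torsionClosure ⟨S, Or.inr (hsingle S)⟩)
        (fun M hM V _ hle => hle _ (Or.inl hM)) (fun M hM => hM T.1 T.2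
          (sup_le hUT (ObjectProperty.singleton_le_iff.2 hS.mem.2))) fun heq => ?_).symm
      refine hmem hBrick hS.mem.1 ?_
      rw [← heq]
      exact fun V _ hle => hle _ (Or.inr (hsingle S))
    · refine le_antisymm (fun M hM => ⟨hUT _ hM, ?_⟩) ?_
      · rintro M ⟨hM, hMS⟩
        by_contra hMU
        -- `M ⟶ F ⟶ S` is a deflation onto a nonzero object, yet it is zero by orthogonality.
        obtain ⟨F, y, hy, hF, hF0⟩ := h.exists_deflation_of_not_mem U.2 T.2 hM hMU
        obtain ⟨f, hf⟩ := hfac hF hF0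
        have hyf := h.isDeflation_comp hy hf
        rw [hMS (y ≫ f) (hsingle S)] at hyf
        exact hS.not_isZero (h.isZero_of_isDeflation_zero hyf)
      · intro Y f hY
        obtain rfl := (ObjectProperty.singleton_iff _ _).1 hY
        exact hS.mem.1 f hM
    · intro S' hS' hmem'
      obtain ⟨f, hf⟩ := hfac hmem' hS'.not_isZero
      refine ⟨?_, S', f, hsingle S', hf⟩
      -- Roles reversed: the image `J` of `g` in `S'` is also a quotient of `S`, and minimality of
      -- `S` gives `S ≅ J`.
      obtain ⟨F', y, g, hy, hg⟩ := h.exists_ne_zero_from_fac U.2 T.2 hUT hcover hS.mem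
        hS.not_isZero hmem' hS'.not_isZero
      obtain ⟨J, i, j, hi, hj, rfl⟩ := h.admissible g
      have hyi := h.isDeflation_comp hy hi
      have hJ0 : ¬ IsZero J := fun hz => hg (by rw [hz.eq_of_tgt i 0, zero_comp])
      have := h.isIso_of_isDeflation hyi (hS.length_le J
        ⟨h.sub_rightOrthogonal_le U.2.fac_le _ ⟨S', j, hmem'.1, hj⟩,
          T.2.fac_le _ ⟨S, y ≫ i, hS.mem.2, hyi⟩⟩ hJ0)
      exact ⟨S', _, hsingle S', h.isInflation_comp (h.isInflation_of_iso (asIso (y ≫ i))) hj⟩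
    · intro S₁ hS₁ hmem₁ hmin
      obtain ⟨f, hf⟩ := hfac hmem₁ hS₁.not_isZero
      -- `S` is itself a brick, so minimality of `S₁` bounds `Θ S₁` by `Θ S`.
      have := h.isIso_of_isDeflation hf (hmin S hBrick hS.mem)
      exact ⟨asIso f⟩
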